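/- Let $n$ be a positive integer and $[n]=\{1,\dots,n\}$. To each family $A\to b$, that is, $b\in[n]$ and $A\subseteq[n]\setminus\{b\}$, associate an invertible indeterminate $y_{A\to b}$ and a (non-invertible) indeterminate $z_{A\to b}$, and let $\mathbb{C}[y^{\pm},z]$ be the ring of polynomials in the $z$'s over the Laurent polynomials in the $y$'s. Let $$R_n=\mathbb{C}[y^{\pm},z]\,/\,\langle\, y_{A\to b}y_{A\cup b\to c}-y_{A\to c}y_{A\cup c\to b},\;\; y_{A\to b}z_{A\cup b\to c}-y_{A\to c}z_{A\cup c\to b} \;:\; b\neq c\in[n],\ A\subseteq[n]\setminus\{b,c\}\,\rangle .$$ The doubled Chickering ideal $\mathcal{C}_n'\subseteq\mathbb{C}[y^{\pm},z]$ is generated by these two families of binomials together with all $z_{A\to b}z_{A\cup b\to c}-z_{A\to c}z_{A\cup c\to b}$, where $b\neq c\in[n]$ and $A\subseteq[n]\setminus\{b,c\}$; it may equally be regarded as an ideal of $R_n$. Let $\mathfrak{B}_n$ be the poset of subsets of $[n]$ with at least two elements, ordered by inclusion. For an upward closed $F\subseteq\mathfrak{B}_n$ and $E\subseteq F$ let $I_{E,F}\subseteq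 R_n$ be the ideal $$\begin{aligned} I_{E,F}={}&\langle z_{A\cup c\to b}\,(z_{A\to b}\,y_{A\to c}-z_{A\to c}\,y_{A\to b}) : A\cup\{b,c\}\in\mathfrak{B}_n\setminus F\rangle\\ &+\langle z_{A\to b} : A\cup\{b\}\in E\rangle\\ &+\langle z_{A\to b}\,y_{A\to c}-z_{A\to c}\,y_{A\to b} : A\cup\{b,c\}\in F\setminus E\rangle,\end{aligned}$$ where $b\ne c$ and $b,c\notin A$ throughout, and for $E\subseteq\mathfrak{B}_n$ put $P_E=I_{E,\mathfrak{B}_n}$. Call an ideal of $\mathbb{C}[y^{\pm},z]$ toric if it is the kernel of a $\mathbb{C}$-algebra homomorphism to a Laurent polynomial ring over $\mathbb{C}$ in finitely many variables which sends each $y_{A\to b}$ to a Laurent monomial and each $z_{A\to b}$ to a Laurent monomial or to $0$. **Proposition.** 1. For every upward closed $F\subseteq\mathfrak{B}_n$ and every $E\subseteq F$, the ideal $I_{E,F}$ is radical. 2. For every $E\subseteq\mathfrak{B}_n$ the ideal $P_E$ is prime (hence primary) in $R_n$, and its preimage in $\mathbb{C}[y^{\pm},z]$ is prime and toric. 3.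 In $R_n$, $$\mathcal{C}_n'=\bigcap_{E\subseteq\mathfrak{B}_n}P_E ,$$ and $\mathcal{C}_n'\subseteq\mathbb{C}[y^{\pm},z]$ is the intersection of the preimages of the $P_E$. In particular this is a (not necessarily irredundant) primary decomposition of $\mathcal{C}_n'$ into toric ideals. -/

import Mathlib

namespace Chickering

/-- Families `A → b` on the vertex set `[n]` (modelled by `Fin n`): a set `A ⊆ [n]` of parents and
a child `b ∈ [n]` with `b ∉ A`. -/
abbrev Family (n : ℕ) : Type := {p : Finset (Fin n) × Fin n // p.2 ∉ p.1}

/-- The family `A → b`. To have a total function of `A` and `b` we erase `b` from `A`, which changes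
nothing when `b ∉ A`; below it is only used for `b ∉ A`. -/
def fam {n : ℕ} (A : Finset (Fin n)) (b : Fin n) : Family n :=
  ⟨(A.erase b, b), Finset.notMem_erase b A⟩

/-- The Laurent polynomial ring `ℂ[t_i^± : i ∈ σ]`, i.e. the group algebra of `ℤ^(σ)`. -/
abbrev Laurent (σ : Type) : Type := AddMonoidAlgebra ℂ (σ →₀ ℤ)

/-- The ring `ℂ[y^±, z]`: polynomials in the variables `z_{A → b}` over the ring of Laurent
polynomials in the variables `y_{A → b}`. -/
abbrev YZRing (n : ℕ) : Type := MvPolynomial (Family n) (Laurent (Family n))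

/-- The invertible variable of `ℂ[y^±, z]` attached to a family. -/
noncomputable def yVar {n : ℕ} (φ : Family n) : YZRing n :=
  MvPolynomial.C (AddMonoidAlgebra.single (Finsupp.single φ 1) 1)

/-- The (non-invertible) variable of `ℂ[y^±, z]` attached to a family. -/
noncomputable def zVar {n : ℕ} (φ : Family n) : YZRing n := MvPolynomial.X φ

/-- `y_{A → b}` -/
noncomputable def y {n : ℕ} (A : Finset (Fin n)) (b : Fin n) : YZRing n := yVar (fam A b)

/-- `z_{A → b}` -/
noncomputable def z {n : ℕ} (A : Finset (Fin n)) (b : Fin n) : YZRing n := zVar (fam A b)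

/-- The binomials `y_{A → b} y_{A ∪ b → c} - y_{A → c} y_{A ∪ c → b}`. -/
def yyGens (n : ℕ) : Set (YZRing n) :=
  {f | ∃ (A : Finset (Fin n)) (b c : Fin n), b ≠ c ∧ b ∉ A ∧ c ∉ A ∧
    f = y A b * y (insert b A) c - y A c * y (insert c A) b}

/-- The binomials `y_{A → b} z_{A ∪ b → c} - y_{A → c} z_{A ∪ c → b}`. -/
def yzGens (n : ℕ) : Set (YZRing n) :=
  {f | ∃ (A : Finset (Fin n)) (b c : Fin n), b ≠ c ∧ b ∉ A ∧ c ∉ A ∧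
    f = y A b * z (insert b A) c - y A c * z (insert c A) b}

/-- The binomials `z_{A → b} z_{A ∪ b → c} - z_{A → c} z_{A ∪ c → b}`. -/
def zzGens (n : ℕ) : Set (YZRing n) :=
  {f | ∃ (A : Finset (Fin n)) (b c : Fin n), b ≠ c ∧ b ∉ A ∧ c ∉ A ∧
    f = z A b * z (insert b A) c - z A c * z (insert c A) b}

/-- The doubled Chickering ideal in `ℂ[y^±, z]`. -/
noncomputable def doubledChickeringIdeal (n : ℕ) : Ideal (YZRing n) :=
  Ideal.span (yyGens n ∪ yzGens n ∪ zzGens n)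

/-- The ideal by which `ℂ[y^±, z]` is divided to obtain `R_n`. -/
noncomputable def relIdeal (n : ℕ) : Ideal (YZRing n) := Ideal.span (yyGens n ∪ yzGens n)

/-- The ring `R_n`. -/
def R (n : ℕ) : Type := YZRing n ⧸ relIdeal n

noncomputable instance (n : ℕ) : CommRing (R n) :=
  inferInstanceAs (CommRing (YZRing n ⧸ relIdeal n))

/-- The quotient map `ℂ[y^±, z] → R_n`. -/
noncomputable def toR (n : ℕ) : YZRing n →+* R n := Ideal.Quotient.mk (relIdeal n)

/-- The poset `𝔅_n` of subsets of `[n]` with at least two elements, ordered by inclusion. -/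
abbrev BPoset (n : ℕ) : Type := {S : Finset (Fin n) // 2 ≤ S.card}

/-- The ideal `I_{E,F} ⊆ R_n`. -/
noncomputable def idealI {n : ℕ} (E F : Set (BPoset n)) : Ideal (R n) :=
  Ideal.span {f | ∃ S : BPoset n, S ∉ F ∧ ∃ (A : Finset (Fin n)) (b c : Fin n),
      b ≠ c ∧ b ∉ A ∧ c ∉ A ∧ A ∪ {b, c} = S.1 ∧
      f = toR n (z (insert c A) b * (z A b * y A c - z A c * y A b))}
  ⊔ Ideal.span {f | ∃ S : BPoset n, S ∈ E ∧ ∃ (A : Finset (Fin n)) (b : Fin n),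
      b ∉ A ∧ A ∪ {b} = S.1 ∧ f = toR n (z A b)}
  ⊔ Ideal.span {f | ∃ S : BPoset n, S ∈ F \ E ∧ ∃ (A : Finset (Fin n)) (b c : Fin n),
      b ≠ c ∧ b ∉ A ∧ c ∉ A ∧ A ∪ {b, c} = S.1 ∧
      f = toR n (z A b * y A c - z A c * y A b)}

/-- The ideal `P_E = I_{E, 𝔅_n} ⊆ R_n`. -/
noncomputable def idealP {n : ℕ} (E : Set (BPoset n)) : Ideal (R n) := idealI E Set.univ

/-- A Laurent monomial `t^m`, with coefficient `1`. -/
def IsLaurentMonomial {σ : Type} (x : Laurent σ) : Prop :=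
  ∃ m : σ →₀ ℤ, x = AddMonoidAlgebra.single m 1

/-- An ideal of `ℂ[y^±, z]` is toric if it is the kernel of a `ℂ`-algebra homomorphism to a Laurent
polynomial ring in finitely many variables that sends every `y`-variable to a Laurent monomial and
every `z`-variable to a Laurent monomial or to `0`. (The value `0` has to be allowed for ideals that
contain some of the `z`-variables.) -/
def IsToric {n : ℕ} (J : Ideal (YZRing n)) : Prop :=
  ∃ (σ : Type) (_ : Finite σ) (f : YZRing n →ₐ[ℂ] Laurent σ),
    (∀ φ : Family n, IsLaurentMonomial (f (yVar φ))) ∧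
    (∀ φ : Family n, f (zVar φ) = 0 ∨ IsLaurentMonomial (f (zVar φ))) ∧
    J = RingHom.ker f

end Chickering

namespace Chickering

open MvPolynomial

/-! ### The structure of $R_n$: one new element $v_S$ per set $S$ -/

section Ring

variable {n : ℕ}

/-! In $R_n$ the $y$'s are units, and the two families of relations together say that $z_{A\to
b}/y_{A\to b}$ depends only on $S=A\cup b$; call it $v_S$. Up to units, the generators of $I_{E,F}$
become $v_S(v_{S\setminus b}-v_{S\setminus c})$ for $S\notin F$, $v_S$ for $S\in E$, and
$v_{S\setminus b}-v_{S\setminus c}$ for $S\in F\setminus E$ (`idealI_eq_choiceIdeal`). So each $S$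
is undecided, set to zero or merged, and $\mathcal C_n'$ is the case where every $S$ is undecided.

Splitting (`choiceIdeal_split`): let $S$ be undecided of maximal size, $J$ the sum of the ideals of
the other sets, $D$ the ideal of the differences for $S$. Then $(J+v_S)\cap(J+D)=J+v_SD$. The reason
is an endomorphism $\varepsilon$ of $R_n$ that kills every $v_U$ with $U$ joined to $S$ by merges.
It preserves $J$, is the identity modulo $J+v_S$, and fixes the generators of $D$, since these
involve only sets smaller than $S$. Iterating, every $I_{E,F}$ is an intersection of ideals
$P_{E'}$.

Primality (`comap_choiceIdeal_eq_ker`): the $y$'s are the coboundary of a unit-valued potential on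
sets, so modulo $P_E$ everything is a monomial in the potentials and in the merge classes of the
$v_S$. Mapping these to independent variables, with $0$ for the classes that contain a set from $E$,
exhibits the preimage of $P_E$ as the kernel of a monomial map to a Laurent ring, which is a domain.
Radicality follows, since an intersection of primes is radical. -/

theorem fam_insert_self (A : Finset (Fin n)) (b : Fin n) : fam (insert b A) b = fam A b := by
  apply Subtype.ext
  simp [fam, Finset.erase_insert_eq_erase]

theorem fam_erase_self (A : Finset (Fin n)) (b : Fin n) : fam (A.erase b) b = fam A b := by
  apply Subtype.ext
  simp [fam]

/-- The set `A ∪ b` attached to a family `A → b`. -/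
def Family.support (φ : Family n) : Finset (Fin n) := insert φ.1.2 φ.1.1

theorem support_fam (A : Finset (Fin n)) (b : Fin n) : (fam A b).support = insert b A := by
  ext a
  by_cases h : a = b <;> simp [Family.support, fam, h]

theorem fam_support (φ : Family n) : fam φ.support φ.1.2 = φ := by
  obtain ⟨⟨A, b⟩, h⟩ := φ
  apply Subtype.ext
  simpa [fam, Family.support] using h

theorem toR_surjective : Function.Surjective (toR n) := Ideal.Quotient.mk_surjective

theorem ker_toR : RingHom.ker (toR n) = relIdeal n := Ideal.mk_ker

theorem toR_eq_of_sub_mem {f g : YZRing n} (h : f - g ∈ relIdeal n) : toR n f = toR n g :=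
  Ideal.Quotient.eq.2 h

theorem toR_y_mul_y {A : Finset (Fin n)} {b c : Fin n} (hbc : b ≠ c) (hb : b ∉ A) (hc : c ∉ A) :
    toR n (y A b) * toR n (y (insert b A) c) = toR n (y A c) * toR n (y (insert c A) b) := by
  rw [← map_mul, ← map_mul]
  exact toR_eq_of_sub_mem (Ideal.subset_span (Or.inl ⟨A, b, c, hbc, hb, hc, rfl⟩))

theorem toR_y_mul_z {A : Finset (Fin n)} {b c : Fin n} (hbc : b ≠ c) (hb : b ∉ A) (hc : c ∉ A) :
    toR n (y A b) * toR n (z (insert b A) c) = toR n (y A c) * toR n (z (insert c A) b) := by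
  rw [← map_mul, ← map_mul]
  exact toR_eq_of_sub_mem (Ideal.subset_span (Or.inr ⟨A, b, c, hbc, hb, hc, rfl⟩))

theorem yVar_mul_inv (φ : Family n) :
    yVar φ * C (AddMonoidAlgebra.single (Finsupp.single φ (-1)) 1) = 1 := by
  rw [yVar, ← C_mul, AddMonoidAlgebra.single_mul_single, ← Finsupp.single_add]
  simp [← AddMonoidAlgebra.one_def]

/-- The class of an invertible variable in `R_n`, as a unit. -/
noncomputable def yUnit (φ : Family n) : (R n)ˣ :=
  Units.mkOfMulEqOne (toR n (yVar φ)) (toR n (C (AddMonoidAlgebra.single (Finsupp.single φ (-1)) 1)))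
    (by rw [← map_mul, yVar_mul_inv, map_one])

theorem coe_yUnit (φ : Family n) : (yUnit φ : R n) = toR n (yVar φ) := rfl

theorem coe_yUnit_fam (A : Finset (Fin n)) (b : Fin n) : (yUnit (fam A b) : R n) = toR n (y A b) :=
  rfl

/-- The quotient `z_{A → b} / y_{A → b}` in `R_n`. -/
noncomputable def ratio (φ : Family n) : R n := toR n (zVar φ) * ↑(yUnit φ)⁻¹

theorem ratio_mul (φ : Family n) : ratio φ * toR n (yVar φ) = toR n (zVar φ) := by
  rw [ratio, ← coe_yUnit, Units.inv_mul_cancel_right]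

theorem ratio_mul_fam (A : Finset (Fin n)) (b : Fin n) :
    ratio (fam A b) * toR n (y A b) = toR n (z A b) := ratio_mul _

/-- Substituting $z=(z/y)\,y$ in the $yz$-relation gives the $yy$-relation with one ratio on each
side; the $y$'s cancel as units. -/
theorem ratio_insert {A : Finset (Fin n)} {b c : Fin n} (hbc : b ≠ c) (hb : b ∉ A) (hc : c ∉ A) :
    ratio (fam (insert b A) c) = ratio (fam (insert c A) b) := by
  have h1 := toR_y_mul_y hbc hb hc
  have h2 := toR_y_mul_z hbc hb hc
  rw [← ratio_mul_fam, ← ratio_mul_fam] at h2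
  have hu : IsUnit (toR n (y A b) * toR n (y (insert b A) c)) :=
    (yUnit (fam A b)).isUnit.mul (yUnit (fam (insert b A) c)).isUnit
  refine hu.mul_left_cancel ?_
  linear_combination h2 - ratio (fam (insert c A) b) * h1

theorem ratio_fam_eq {S : Finset (Fin n)} {b c : Fin n} (hb : b ∈ S) (hc : c ∈ S) :
    ratio (fam S b) = ratio (fam S c) := by
  rcases eq_or_ne b c with rfl | hbc
  · rfl
  have h := ratio_insert (A := (S.erase b).erase c) (b := b) (c := c) hbc (by simp) (by simp)
  rw [Finset.insert_erase (by simp [hc, hbc.symm]), Finset.erase_right_comm,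
    Finset.insert_erase (by simp [hb, hbc]), fam_erase_self, fam_erase_self] at h
  exact h.symm

/-- The common value in `R_n` of the quotients `z_{A → b} / y_{A → b}` with `A ∪ b = S`. -/
noncomputable def v (S : Finset (Fin n)) : R n :=
  -- The minimum is an arbitrary choice of child. The value at $\emptyset$ is junk, as $\emptyset$
  -- is never of the form $A\cup b$.
  if h : S.Nonempty then ratio (fam S (S.min' h)) else 0

theorem v_eq_ratio {S : Finset (Fin n)} {b : Fin n} (hb : b ∈ S) : v S = ratio (fam S b) := by
  rw [v, dif_pos ⟨b, hb⟩]
  exact ratio_fam_eq (Finset.min'_mem _ _) hb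

theorem toR_z (A : Finset (Fin n)) (b : Fin n) :
    toR n (z A b) = v (insert b A) * toR n (y A b) := by
  rw [v_eq_ratio (Finset.mem_insert_self b A), fam_insert_self, ratio_mul_fam]

theorem toR_zVar (φ : Family n) : toR n (zVar φ) = v φ.support * toR n (yVar φ) := by
  rw [v_eq_ratio (S := φ.support) (b := φ.1.2) (Finset.mem_insert_self _ _), fam_support,
    ratio_mul]

theorem ringHom_ext {Q : Type*} [CommRing Q] {f g : YZRing n →+* Q}
    (hC : ∀ a : ℂ, f (algebraMap ℂ _ a) = g (algebraMap ℂ _ a))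
    (hy : ∀ φ, f (yVar φ) = g (yVar φ)) (hz : ∀ φ, f (zVar φ) = g (zVar φ)) : f = g := by
  refine MvPolynomial.ringHom_ext' ?_ hz
  refine AddMonoidAlgebra.ringHom_ext' ?_ ?_
  · ext a
    exact hC a
  · refine MonoidHom.toAdditiveRight.injective (Finsupp.addHom_ext' fun φ => ?_)
    exact AddMonoidHom.ext_int (hy φ)

end Ring

/-! ### Endomorphisms of $R_n$ that kill chosen $v_S$ -/

section Collapse

variable {n : ℕ}

open Classical in
/-- The endomorphism of `ℂ[y^±, z]` that kills the `z_{A → b}` with `A ∪ b ∈ K` and fixes all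
other variables. -/
noncomputable def collapseYZ (K : Set (Finset (Fin n))) : YZRing n →+* YZRing n :=
  eval₂Hom C fun φ => if φ.support ∈ K then 0 else X φ

theorem collapseYZ_C (K : Set (Finset (Fin n))) (a : Laurent (Family n)) :
    collapseYZ K (C a) = C a := by
  simp [collapseYZ]

theorem collapseYZ_y (K : Set (Finset (Fin n))) (A : Finset (Fin n)) (b : Fin n) :
    collapseYZ K (y A b) = y A b := collapseYZ_C K _

open Classical in
theorem collapseYZ_zVar (K : Set (Finset (Fin n))) (φ : Family n) :
    collapseYZ K (zVar φ) = if φ.support ∈ K then 0 else zVar φ := by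
  simp [collapseYZ, zVar]

open Classical in
theorem collapseYZ_z (K : Set (Finset (Fin n))) (A : Finset (Fin n)) (b : Fin n) :
    collapseYZ K (z A b) = if insert b A ∈ K then 0 else z A b := by
  rw [z, collapseYZ_zVar, support_fam]

/-- The endomorphism of `R_n` induced by `collapseYZ`. -/
noncomputable def collapse (K : Set (Finset (Fin n))) : R n →+* R n :=
  Ideal.Quotient.lift (relIdeal n) ((toR n).comp (collapseYZ K)) <| by
    suffices h : relIdeal n ≤ RingHom.ker ((toR n).comp (collapseYZ K)) from fun a ha => h ha
    rw [relIdeal, Ideal.span_le]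
    rintro _ (⟨A, b, c, hbc, hb, hc, rfl⟩ | ⟨A, b, c, hbc, hb, hc, rfl⟩)
    · rw [SetLike.mem_coe, RingHom.mem_ker]
      simp [collapseYZ_y, toR_y_mul_y hbc hb hc]
    · rw [SetLike.mem_coe, RingHom.mem_ker]
      have h := toR_y_mul_z hbc hb hc
      simp only [RingHom.comp_apply, map_sub, map_mul, collapseYZ_y, collapseYZ_z]
      -- Both $z$'s in the relation belong to the set $A\cup\{b,c\}$, so they are killed together or
      -- not at all.
      rw [Finset.insert_comm c b A]
      by_cases hK : insert b (insert c A) ∈ K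
      · simp [hK]
      · rw [if_neg hK, if_neg hK, h, sub_self]

theorem collapse_toR (K : Set (Finset (Fin n))) (f : YZRing n) :
    collapse K (toR n f) = toR n (collapseYZ K f) := rfl

theorem v_of_not_nonempty {S : Finset (Fin n)} (hS : ¬ S.Nonempty) : (v S : R n) = 0 := dif_neg hS

open Classical in
theorem collapse_v (K : Set (Finset (Fin n))) (S : Finset (Fin n)) :
    collapse K (v S) = if S ∈ K then 0 else v S := by
  by_cases hS : S.Nonempty
  · obtain ⟨b, hb⟩ := hS
    have h := congrArg (collapse K) (toR_z (S.erase b) b)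
    rw [Finset.insert_erase hb, map_mul, collapse_toR, collapse_toR, collapseYZ_y, collapseYZ_z,
      Finset.insert_erase hb] at h
    refine (yUnit (fam (S.erase b) b)).isUnit.mul_right_cancel ?_
    rw [coe_yUnit_fam, ← h]
    split_ifs
    · simp
    · rw [toR_z, Finset.insert_erase hb]
  · simp [v_of_not_nonempty hS]

theorem collapse_v_of_mem {K : Set (Finset (Fin n))} {S : Finset (Fin n)} (h : S ∈ K) :
    collapse K (v S) = 0 := by
  rw [collapse_v, if_pos h]

theorem collapse_v_of_notMem {K : Set (Finset (Fin n))} {S : Finset (Fin n)} (h : S ∉ K) :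
    collapse K (v S) = v S := by
  rw [collapse_v, if_neg h]

/-- `collapse K` changes only variables $z_{A\to b}=v_{A\cup b}\,y_{A\to b}$ with $A\cup b\in K$,
and these already vanish modulo $I$. -/
theorem sub_collapse_mem {K : Set (Finset (Fin n))} {I : Ideal (R n)} (h : ∀ S ∈ K, v S ∈ I)
    (x : R n) : x - collapse K x ∈ I := by
  obtain ⟨f, rfl⟩ := toR_surjective x
  rw [← Ideal.Quotient.eq, collapse_toR]
  suffices e : (Ideal.Quotient.mk I).comp (toR n) =
      (Ideal.Quotient.mk I).comp ((toR n).comp (collapseYZ K)) from RingHom.congr_fun e f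
  refine MvPolynomial.ringHom_ext (fun a => ?_) fun φ => ?_
  · simp [collapseYZ_C]
  · change _ = Ideal.Quotient.mk I (toR n (collapseYZ K (zVar φ)))
    rw [collapseYZ_zVar]
    split_ifs with hφ
    · rw [map_zero, map_zero]
      refine Ideal.Quotient.eq_zero_iff_mem.2 ?_
      change toR n (zVar φ) ∈ I
      rw [toR_zVar]
      exact I.mul_mem_right _ (h _ hφ)
    · rfl

end Collapse

/-! ### Splitting off one undecided set at a time -/

section Decomposition

/-- A splitting criterion for ideals, by means of an endomorphism `ε` killing `u` and fixing `D`. -/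
theorem sup_inf_sup_span_eq {Q : Type*} [CommRing Q] (J : Ideal Q) (u : Q) (X : Set Q)
    (ε : Q →+* Q) (hJ : J ≤ J.comap ε) (hu : ε u = 0) (hX : ∀ d ∈ X, ε d = d)
    (hε : ∀ x, x - ε x ∈ J ⊔ Ideal.span {u}) :
    (J ⊔ Ideal.span {u}) ⊓ (J ⊔ Ideal.span X) = J ⊔ Ideal.span {u} * Ideal.span X := by
  apply le_antisymm
  · rintro x ⟨h1, h2⟩
    have hx : ε x ∈ J := by
      have : J ⊔ Ideal.span {u} ≤ J.comap ε :=
        sup_le hJ (by simp [Ideal.span_le, hu])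
      exact this h1
    -- For $d=\sum a_i d_i$ with $d_i\in X$ fixed by $\varepsilon$, the difference is
    -- $\sum(a_i-\varepsilon a_i)d_i$, and $a_i-\varepsilon a_i\in J+(u)$.
    have hD : ∀ d ∈ Ideal.span X, d - ε d ∈ J ⊔ Ideal.span {u} * Ideal.span X := by
      intro d hd
      induction hd using Submodule.span_induction with
      | mem d hd => simp [hX d hd]
      | zero => simp
      | add a b _ _ ha hb =>
        rw [map_add, add_sub_add_comm]
        exact add_mem ha hb
      | smul a d hd ih =>
        have e : a • d - ε (a • d) = (a - ε a) * d + ε a * (d - ε d) := by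
          rw [smul_eq_mul, map_mul]
          ring
        rw [e]
        refine add_mem ?_ (Ideal.mul_mem_left _ _ ih)
        have := Ideal.mul_mem_mul (hε a) hd
        rw [Ideal.sup_mul] at this
        exact sup_le_sup_right (Ideal.mul_le_left (I := J)) _ this
    obtain ⟨j, hj, d, hd, rfl⟩ := Submodule.mem_sup.1 h2
    -- The last summand lies in $J$ because $j+d\in J+(u)$ and $\varepsilon$ maps $J+(u)$ into $J$.
    have e : j + d = (j - ε j) + (d - ε d) + ε (j + d) := by
      rw [map_add]
      ring
    rw [e]
    exact add_mem (add_mem (Ideal.mem_sup_left (sub_mem hj (hJ hj))) (hD d hd))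
      (Ideal.mem_sup_left hx)
  · exact le_inf (sup_le_sup_left Ideal.mul_le_left _) (sup_le_sup_left Ideal.mul_le_right _)

variable {n : ℕ}

/-- The differences `v_{S ∖ b} - v_{S ∖ c}`. -/
def diffs (S : Finset (Fin n)) : Set (R n) :=
  {f | ∃ b ∈ S, ∃ c ∈ S, f = v (S.erase b) - v (S.erase c)}

/-- The ideal of conditions that `S` contributes: `v_S = 0`, or that all `v_{S ∖ b}` coincide, or,
if no choice between the two was made, that the products of both vanish. -/
noncomputable def stepIdeal (S : Finset (Fin n)) : Option Bool → Ideal (R n)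
  | none => Ideal.span {v S} * Ideal.span (diffs S)
  | some true => Ideal.span {v S}
  | some false => Ideal.span (diffs S)

/-- The sum of the ideals `stepIdeal S (s S)`. -/
noncomputable def choiceIdeal (s : BPoset n → Option Bool) : Ideal (R n) :=
  ⨆ S, stepIdeal S.1 (s S)

/-- Two sets are linked if their `v` are identified by some `T` with `s T = some false`. -/
def Linked (s : BPoset n → Option Bool) (U V : Finset (Fin n)) : Prop :=
  ∃ T : BPoset n, s T = some false ∧ ∃ b ∈ T.1, ∃ c ∈ T.1, U = T.1.erase b ∧ V = T.1.erase c

theorem Linked.symm {s : BPoset n → Option Bool} {U V : Finset (Fin n)} (h : Linked s U V) :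
    Linked s V U := by
  obtain ⟨T, hT, b, hb, c, hc, hU, hV⟩ := h
  exact ⟨T, hT, c, hc, b, hb, hV, hU⟩

theorem Linked.card_eq {s : BPoset n → Option Bool} {U V : Finset (Fin n)} (h : Linked s U V) :
    V.card = U.card := by
  obtain ⟨T, hT, b, hb, c, hc, rfl, rfl⟩ := h
  rw [Finset.card_erase_of_mem hb, Finset.card_erase_of_mem hc]

/-- The sets joined to `S` by a chain of links. -/
def linkClass (s : BPoset n → Option Bool) (S : Finset (Fin n)) : Set (Finset (Fin n)) :=
  {V | Relation.ReflTransGen (Linked s) S V}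

/-- Links preserve size. This is what keeps the collapse of a link class away from differences of
smaller sets. -/
theorem card_of_mem_linkClass {s : BPoset n → Option Bool} {S V : Finset (Fin n)}
    (h : V ∈ linkClass s S) : V.card = S.card := by
  induction h with
  | refl => rfl
  | tail _ h ih => rw [h.card_eq, ih]

theorem mem_linkClass_iff {s : BPoset n → Option Bool} {S U V : Finset (Fin n)}
    (h : Linked s U V) : U ∈ linkClass s S ↔ V ∈ linkClass s S :=
  ⟨fun hU => Relation.ReflTransGen.tail hU h, fun hV => Relation.ReflTransGen.tail hV h.symm⟩

/-- The sum of the ideals `stepIdeal T (s T)` over `T ≠ S`. -/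
noncomputable def restIdeal (s : BPoset n → Option Bool) (S : BPoset n) : Ideal (R n) :=
  ⨆ (T) (_ : T ≠ S), stepIdeal T.1 (s T)

theorem choiceIdeal_update [DecidableEq (BPoset n)] (s : BPoset n → Option Bool) (S : BPoset n)
    (o : Option Bool) :
    choiceIdeal (Function.update s S o) = restIdeal s S ⊔ stepIdeal S.1 o := by
  rw [choiceIdeal, iSup_split_single _ S, sup_comm, Function.update_self, restIdeal]
  congr 1
  refine iSup_congr fun T => iSup_congr fun hT => ?_
  rw [Function.update_of_ne hT]

theorem v_sub_v_mem_restIdeal {s : BPoset n → Option Bool} {S : BPoset n} (hS : s S = none)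
    {U V : Finset (Fin n)} (h : Linked s U V) : v U - v V ∈ restIdeal s S := by
  obtain ⟨T, hT, b, hb, c, hc, rfl, rfl⟩ := h
  have hne : T ≠ S := by
    rintro rfl
    simp [hS] at hT
  refine le_iSup₂ (f := fun (T : BPoset n) (_ : T ≠ S) => stepIdeal T.1 (s T)) T hne ?_
  simp only [hT]
  exact Ideal.subset_span ⟨b, hb, c, hc, rfl⟩

theorem v_mem_of_mem_linkClass {s : BPoset n → Option Bool} {S : BPoset n} (hS : s S = none)
    {V : Finset (Fin n)} (h : V ∈ linkClass s S.1) : v V ∈ restIdeal s S ⊔ Ideal.span {v S.1} := by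
  induction h with
  | refl => exact Ideal.mem_sup_right (Ideal.mem_span_singleton_self _)
  | tail _ h ih =>
    have := sub_mem ih (Ideal.mem_sup_left (v_sub_v_mem_restIdeal hS h))
    rwa [sub_sub_cancel] at this

theorem collapse_diff {K : Set (Finset (Fin n))} {T : Finset (Fin n)}
    (h : ∀ b ∈ T, T.erase b ∉ K) {d : R n} (hd : d ∈ diffs T) : collapse K d = d := by
  obtain ⟨b, hb, c, hc, rfl⟩ := hd
  rw [map_sub, collapse_v_of_notMem (h b hb), collapse_v_of_notMem (h c hc)]

/-- Each kind of generator is sent to $0$ or to itself. Merge differences have both terms in the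
link class or neither; an undecided $T$ has $|T\setminus b|<|T|\le|S|$, so its differences are
untouched; and $v_T$ itself is killed or fixed. -/
theorem restIdeal_le_comap_collapse {s : BPoset n → Option Bool} {S : BPoset n}
    (hmax : ∀ T : BPoset n, s T = none → T.1.card ≤ S.1.card) :
    restIdeal s S ≤ (restIdeal s S).comap (collapse (linkClass s S.1)) := by
  conv_lhs => rw [restIdeal]
  refine iSup₂_le fun T hT => ?_
  have hle : stepIdeal T.1 (s T) ≤ restIdeal s S :=
    le_iSup₂ (f := fun (T : BPoset n) (_ : T ≠ S) => stepIdeal T.1 (s T)) T hT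
  have hv : collapse (linkClass s S.1) (v T.1) = 0 ∨
      collapse (linkClass s S.1) (v T.1) = v T.1 := by
    by_cases h : T.1 ∈ linkClass s S.1
    · exact Or.inl (collapse_v_of_mem h)
    · exact Or.inr (collapse_v_of_notMem h)
  rcases hs : s T with _ | _ | _
  · rw [hs] at hle
    simp only [stepIdeal] at hle ⊢
    rw [Ideal.span_mul_span', Ideal.span_le]
    rintro _ ⟨_, rfl, d, hd, rfl⟩
    simp only [SetLike.mem_coe, Ideal.mem_comap, map_mul]
    rw [collapse_diff (T := T.1) ?_ hd]
    · rcases hv with h | h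
      · simp [h]
      · rw [h]
        exact hle (Ideal.mul_mem_mul (Ideal.mem_span_singleton_self _) (Ideal.subset_span hd))
    · intro b hb hmem
      have h1 := card_of_mem_linkClass hmem
      have h2 := Finset.card_erase_lt_of_mem hb
      have h3 := hmax T hs
      omega
  · rw [hs] at hle
    simp only [stepIdeal] at hle ⊢
    rw [Ideal.span_le]
    rintro _ ⟨b, hb, c, hc, rfl⟩
    have hl : Linked s (T.1.erase b) (T.1.erase c) := ⟨T, hs, b, hb, c, hc, rfl, rfl⟩
    simp only [SetLike.mem_coe, Ideal.mem_comap, map_sub]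
    by_cases h : T.1.erase b ∈ linkClass s S.1
    · rw [collapse_v_of_mem h, collapse_v_of_mem ((mem_linkClass_iff hl).1 h), sub_zero]
      exact zero_mem _
    · rw [collapse_v_of_notMem h, collapse_v_of_notMem (mt (mem_linkClass_iff hl).2 h)]
      exact hle (Ideal.subset_span ⟨b, hb, c, hc, rfl⟩)
  · rw [hs] at hle
    simp only [stepIdeal] at hle ⊢
    rw [Ideal.span_le, Set.singleton_subset_iff, SetLike.mem_coe, Ideal.mem_comap]
    rcases hv with h | h
    · simp [h]
    · rw [h]
      exact hle (Ideal.mem_span_singleton_self _)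

theorem choiceIdeal_split [DecidableEq (BPoset n)] {s : BPoset n → Option Bool} {S : BPoset n}
    (hS : s S = none) (hmax : ∀ T : BPoset n, s T = none → T.1.card ≤ S.1.card) :
    choiceIdeal s = choiceIdeal (Function.update s S (some true)) ⊓
      choiceIdeal (Function.update s S (some false)) := by
  conv_lhs => rw [← Function.update_eq_self S s, hS]
  rw [choiceIdeal_update, choiceIdeal_update, choiceIdeal_update]
  refine (sup_inf_sup_span_eq _ _ _ (collapse (linkClass s S.1))
    (restIdeal_le_comap_collapse hmax) (collapse_v_of_mem Relation.ReflTransGen.refl) ?_ ?_).symm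
  · refine fun d hd => collapse_diff (fun b hb hmem => ?_) hd
    have h1 := card_of_mem_linkClass hmem
    have h2 := Finset.card_erase_lt_of_mem hb
    omega
  · exact sub_collapse_mem fun V hV => v_mem_of_mem_linkClass hS hV

theorem stepIdeal_none_le (S : Finset (Fin n)) (o : Option Bool) :
    stepIdeal S none ≤ stepIdeal S o := by
  rcases o with _ | _ | _
  · exact le_rfl
  · exact Ideal.mul_le_right (I := Ideal.span {v S})
  · exact Ideal.mul_le_left (J := Ideal.span (diffs S))

/-- `choiceIdeal s` is the intersection of the `choiceIdeal t` over all total choices `t` that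
extend `s`. -/
theorem choiceIdeal_eq_iInf (s : BPoset n → Option Bool) :
    choiceIdeal s = ⨅ (t : BPoset n → Bool) (_ : ∀ S b, s S = some b → t S = b),
      choiceIdeal (fun S => some (t S)) := by
  classical
  apply le_antisymm
  · refine le_iInf₂ fun t ht => iSup_mono fun S => ?_
    rcases hs : s S with _ | b
    · exact stepIdeal_none_le _ _
    · simp only [ht S b hs, le_refl]
  -- Induction on the number of undecided sets. The set to split must be a largest undecided one, as
  -- the collapse argument requires.
  · induction hk : (Finset.univ.filter fun S => s S = none).card using Nat.strong_induction_on
      generalizing s with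
    | _ k ih =>
    rcases (Finset.univ.filter fun S => s S = none).eq_empty_or_nonempty with h0 | hne
    · rw [Finset.filter_eq_empty_iff] at h0
      choose t ht using fun S => Option.ne_none_iff_exists'.1 (h0 (Finset.mem_univ S))
      refine iInf₂_le_of_le t (fun S b h => ?_) ?_
      · simpa [ht S] using h
      · rw [show s = fun S => some (t S) from funext ht]
    · obtain ⟨S, hS, hmax⟩ := Finset.exists_max_image _ (fun S : BPoset n => S.1.card) hne
      simp only [Finset.mem_filter, Finset.mem_univ, true_and] at hS hmax
      have key : ∀ b : Bool, (⨅ (t : BPoset n → Bool) (_ : ∀ S b, s S = some b → t S = b),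
          choiceIdeal (fun S => some (t S))) ≤ choiceIdeal (Function.update s S (some b)) := by
        intro b
        refine le_trans ?_ (ih _ ?_ (Function.update s S (some b)) rfl)
        · refine le_iInf₂ fun t ht => iInf₂_le t fun T c hT => ?_
          refine ht T c ?_
          rwa [Function.update_of_ne]
          rintro rfl
          simp [hS] at hT
        · rw [← hk]
          refine Finset.card_lt_card (Finset.ssubset_iff_of_subset ?_ |>.2 ⟨S, ?_, ?_⟩)
          · intro T hT
            simp only [Finset.mem_filter, Finset.mem_univ, true_and] at hT ⊢
            rcases eq_or_ne T S with rfl | h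
            · exact hS
            · rwa [Function.update_of_ne h] at hT
          · simpa using hS
          · simp
      rw [choiceIdeal_split hS hmax]
      exact le_inf (key true) (key false)

end Decomposition

/-! ### Translating the ideals of the statement into conditions on the $v_S$ -/

section Conversion

variable {n : ℕ}

open Classical in
/-- The choices recorded by `E` and `F`: `S ∈ E` is set to zero, `S ∈ F \ E` is merged. -/
noncomputable def choiceOf (E F : Set (BPoset n)) (S : BPoset n) : Option Bool :=
  if S ∈ E then some true else if S ∈ F then some false else none

theorem toR_binomial (A : Finset (Fin n)) (b c : Fin n) :
    toR n (z A b * y A c - z A c * y A b) =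
      (v (insert b A) - v (insert c A)) * (toR n (y A b) * toR n (y A c)) := by
  rw [map_sub, map_mul, map_mul, toR_z, toR_z]
  ring

theorem mul_y_mem_iff {I : Ideal (R n)} {x : R n} (A : Finset (Fin n)) (b : Fin n) :
    x * toR n (y A b) ∈ I ↔ x ∈ I :=
  Ideal.mul_unit_mem_iff_mem I (yUnit (fam A b)).isUnit

theorem mul_y_mul_y_mem_iff {I : Ideal (R n)} {x : R n} (A : Finset (Fin n)) (b c : Fin n) :
    x * (toR n (y A b) * toR n (y A c)) ∈ I ↔ x ∈ I := by
  rw [← mul_assoc, mul_y_mem_iff, mul_y_mem_iff]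

theorem erase_erase_data {S : Finset (Fin n)} {b c : Fin n} (hbc : b ≠ c) (hb : b ∈ S)
    (hc : c ∈ S) : insert b ((S.erase b).erase c) = S.erase c ∧
      insert c ((S.erase b).erase c) = S.erase b ∧ (S.erase b).erase c ∪ {b, c} = S := by
  refine ⟨?_, ?_, ?_⟩
  · rw [Finset.erase_right_comm, Finset.insert_erase (by simp [hb, hbc])]
  · rw [Finset.insert_erase (by simp [hc, hbc.symm])]
  · ext a
    by_cases h1 : a = b <;> by_cases h2 : a = c <;> simp [h1, h2, hb, hc]

theorem insert_eq_erase_union {A : Finset (Fin n)} {b c : Fin n} (hbc : b ≠ c) (hc : c ∉ A) :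
    insert b A = (A ∪ {b, c}).erase c := by
  ext a
  by_cases h1 : a = b <;> by_cases h2 : a = c <;> simp [h1, h2, hbc, hbc.symm, hc]

theorem diff_mem_diffs {A : Finset (Fin n)} {b c : Fin n} (hbc : b ≠ c) (hb : b ∉ A)
    (hc : c ∉ A) : v (insert b A) - v (insert c A) ∈ diffs (A ∪ {b, c}) := by
  refine ⟨c, by simp, b, by simp, ?_⟩
  rw [insert_eq_erase_union hbc hc, insert_eq_erase_union hbc.symm hb, Finset.pair_comm c b]

theorem le_choiceIdeal (s : BPoset n → Option Bool) (S : BPoset n) :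
    stepIdeal S.1 (s S) ≤ choiceIdeal s := le_iSup (fun S : BPoset n => stepIdeal S.1 (s S)) S

theorem insert_insert_eq_union (A : Finset (Fin n)) (b c : Fin n) :
    insert b (insert c A) = A ∪ {b, c} := by
  ext a
  simp only [Finset.mem_insert, Finset.mem_union, Finset.mem_singleton]
  tauto

/-- Up to units, the generator for an undecided $S=A\cup\{b,c\}$ is the product of the two
alternatives: $S$ set to zero, or $S$ merged. -/
theorem toR_trinomial (A : Finset (Fin n)) (b c : Fin n) :
    toR n (z (insert c A) b * (z A b * y A c - z A c * y A b)) =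
      v (A ∪ {b, c}) * (v (insert b A) - v (insert c A)) *
        (toR n (y A b) * toR n (y A c)) * toR n (y (insert c A) b) := by
  rw [map_mul, toR_binomial, toR_z, insert_insert_eq_union]
  ring

theorem idealI_eq_choiceIdeal {E F : Set (BPoset n)} (hEF : E ⊆ F) :
    idealI E F = choiceIdeal (choiceOf E F) := by
  apply le_antisymm
  · rw [idealI]
    refine sup_le (sup_le ?_ ?_) ?_ <;> rw [Ideal.span_le]
    · rintro _ ⟨S, hS, A, b, c, hbc, hb, hc, hA, rfl⟩
      have h := le_choiceIdeal (choiceOf E F) S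
      rw [choiceOf, if_neg fun h => hS (hEF h), if_neg hS] at h
      rw [SetLike.mem_coe, toR_trinomial, mul_y_mem_iff, mul_y_mul_y_mem_iff]
      refine h (Ideal.mul_mem_mul ?_ (Ideal.subset_span ?_))
      · rw [hA]
        exact Ideal.mem_span_singleton_self _
      · rw [← hA]
        exact diff_mem_diffs hbc hb hc
    · rintro _ ⟨S, hS, A, b, hb, hA, rfl⟩
      have h := le_choiceIdeal (choiceOf E F) S
      rw [choiceOf, if_pos hS] at h
      rw [SetLike.mem_coe, toR_z, mul_y_mem_iff, Finset.insert_eq, Finset.union_comm, hA]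
      exact h (Ideal.mem_span_singleton_self _)
    · rintro _ ⟨S, hS, A, b, c, hbc, hb, hc, hA, rfl⟩
      have h := le_choiceIdeal (choiceOf E F) S
      rw [choiceOf, if_neg hS.2, if_pos hS.1] at h
      rw [SetLike.mem_coe, toR_binomial, mul_y_mul_y_mem_iff]
      refine h (Ideal.subset_span ?_)
      rw [← hA]
      exact diff_mem_diffs hbc hb hc
  · refine iSup_le fun S => ?_
    rw [choiceOf]
    split_ifs with h1 h2
    · simp only [stepIdeal]
      rw [Ideal.span_le, Set.singleton_subset_iff]
      obtain ⟨b, hb⟩ : S.1.Nonempty := Finset.card_pos.1 (by have := S.2; omega)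
      refine Ideal.mem_sup_left (Ideal.mem_sup_right ?_)
      have hS : S.1.erase b ∪ {b} = S.1 := by
        rw [Finset.union_comm, ← Finset.insert_eq, Finset.insert_erase hb]
      rw [← mul_y_mem_iff (S.1.erase b) b]
      refine Ideal.subset_span ⟨S, h1, S.1.erase b, b, by simp, hS, ?_⟩
      rw [toR_z, Finset.insert_erase hb]
    · simp only [stepIdeal]
      rw [Ideal.span_le]
      rintro _ ⟨b, hb, c, hc, rfl⟩
      rcases eq_or_ne b c with rfl | hbc
      · simp
      obtain ⟨e1, e2, e3⟩ := erase_erase_data hbc hb hc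
      refine Ideal.mem_sup_right ?_
      -- The pair is used in the order $c,b$, since adding $c$ to $S\setminus\{b,c\}$ yields
      -- $S\setminus b$, the first term of the difference.
      rw [← mul_y_mul_y_mem_iff ((S.1.erase b).erase c) c b]
      refine Ideal.subset_span ⟨S, ⟨h2, h1⟩, (S.1.erase b).erase c, c, b, hbc.symm, by simp,
        by simp, by rwa [Finset.pair_comm], ?_⟩
      rw [toR_binomial, e1, e2]
    · simp only [stepIdeal]
      rw [Ideal.span_mul_span', Ideal.span_le]
      rintro _ ⟨_, rfl, _, ⟨b, hb, c, hc, rfl⟩, rfl⟩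
      rcases eq_or_ne b c with rfl | hbc
      · simp
      obtain ⟨e1, e2, e3⟩ := erase_erase_data hbc hb hc
      refine Ideal.mem_sup_left (Ideal.mem_sup_left ?_)
      dsimp only
      rw [← mul_y_mul_y_mem_iff ((S.1.erase b).erase c) c b,
        ← mul_y_mem_iff (insert b ((S.1.erase b).erase c)) c]
      refine Ideal.subset_span ⟨S, h2, (S.1.erase b).erase c, c, b, hbc.symm, by simp,
        by simp, by rwa [Finset.pair_comm], ?_⟩
      rw [toR_trinomial, e1, e2, Finset.pair_comm, e3]

/-- The $yz$-relation replaces $y_{A\to b}z_{A\cup b\to c}$ by $y_{A\to c}z_{A\cup c\to b}$. Hence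
in $R_n$ the $zz$-binomials and the generators of $I_{\emptyset,\emptyset}$ agree up to units. -/
theorem toR_zz_mul {A : Finset (Fin n)} {b c : Fin n} (hbc : b ≠ c) (hb : b ∉ A) (hc : c ∉ A) :
    toR n (z A b * z (insert b A) c - z A c * z (insert c A) b) * toR n (y A b) =
      toR n (z (insert c A) b * (z A b * y A c - z A c * y A b)) := by
  simp only [map_sub, map_mul]
  linear_combination toR n (z A b) * toR_y_mul_z hbc hb hc

theorem map_doubledChickeringIdeal :
    (doubledChickeringIdeal n).map (toR n) = idealI ∅ ∅ := by
  apply le_antisymm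
  · rw [Ideal.map_le_iff_le_comap, doubledChickeringIdeal, Ideal.span_le]
    rintro f (hf | ⟨A, b, c, hbc, hb, hc, rfl⟩)
    · have h : toR n f = 0 := by
        rw [← RingHom.mem_ker, ker_toR]
        exact Ideal.subset_span hf
      rw [SetLike.mem_coe, Ideal.mem_comap, h]
      exact zero_mem _
    · rw [SetLike.mem_coe, Ideal.mem_comap, ← mul_y_mem_iff A b, toR_zz_mul hbc hb hc]
      have hcard : 2 ≤ (A ∪ {b, c}).card := by
        rw [← Finset.card_pair hbc]
        exact Finset.card_le_card Finset.subset_union_right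
      exact Ideal.mem_sup_left (Ideal.mem_sup_left (Ideal.subset_span
        ⟨⟨A ∪ {b, c}, hcard⟩, Set.notMem_empty _, A, b, c, hbc, hb, hc, rfl, rfl⟩))
  · rw [idealI]
    refine sup_le (sup_le ?_ ?_) ?_ <;> rw [Ideal.span_le]
    · rintro _ ⟨S, -, A, b, c, hbc, hb, hc, -, rfl⟩
      rw [← toR_zz_mul hbc hb hc, SetLike.mem_coe, mul_y_mem_iff]
      exact Ideal.mem_map_of_mem _ (Ideal.subset_span (Or.inr ⟨A, b, c, hbc, hb, hc, rfl⟩))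
    · rintro _ ⟨S, hS, -⟩
      exact hS.elim
    · rintro _ ⟨S, hS, -⟩
      exact hS.1.elim

theorem relIdeal_le : relIdeal n ≤ doubledChickeringIdeal n :=
  Ideal.span_mono Set.subset_union_left

theorem comap_map_doubledChickeringIdeal :
    ((doubledChickeringIdeal n).map (toR n)).comap (toR n) = doubledChickeringIdeal n := by
  rw [Ideal.comap_map_of_surjective _ toR_surjective, ← RingHom.ker_eq_comap_bot, ker_toR,
    sup_eq_left]
  exact relIdeal_le

theorem choiceOf_univ (t : BPoset n → Bool) :
    choiceOf {S | t S = true} Set.univ = fun S => some (t S) := by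
  funext S
  by_cases h : t S = true
  · simp [choiceOf, h]
  · simp [choiceOf, h]

theorem idealP_eq_choiceIdeal (t : BPoset n → Bool) :
    idealP {S | t S = true} = choiceIdeal fun S => some (t S) := by
  rw [idealP, idealI_eq_choiceIdeal (Set.subset_univ _), choiceOf_univ]

end Conversion

/-! ### The $y$'s as the coboundary of a potential -/

section Potential

variable {n : ℕ}

theorem yUnit_mul {A : Finset (Fin n)} {b c : Fin n} (hbc : b ≠ c) (hb : b ∉ A) (hc : c ∉ A) :
    yUnit (fam A b) * yUnit (fam (insert b A) c) = yUnit (fam A c) * yUnit (fam (insert c A) b) :=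
  Units.ext (toR_y_mul_y hbc hb hc)

/-- A potential for the variables `y`: the product of the `y`'s along the increasing chain from
`∅` to `S`. -/
noncomputable def potential (S : Finset (Fin n)) : (R n)ˣ :=
  ∏ b ∈ S, yUnit (fam (S.filter (· < b)) b)

theorem potential_insert_max {A : Finset (Fin n)} {c : Fin n} (h : ∀ a ∈ A, a < c) :
    potential (insert c A) = potential A * yUnit (fam A c) := by
  have hc : c ∉ A := fun hc => lt_irrefl c (h c hc)
  rw [potential, Finset.prod_insert hc, mul_comm, potential]
  congr 1
  · refine Finset.prod_congr rfl fun b hb => ?_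
    rw [Finset.filter_insert, if_neg (h b hb).le.not_gt]
  · rw [Finset.filter_insert, if_neg (lt_irrefl c), Finset.filter_true_of_mem h]

/-- Path independence: the $yy$-relations say that the two ways around each square $A,\ A\cup b,\
A\cup c,\ A\cup\{b,c\}$ agree. Induction on the maximum $c$ moves a smaller $b$ past $c$ through one
such square; a $b$ above $c$ is a new maximum. -/
theorem potential_insert (A : Finset (Fin n)) :
    ∀ b ∉ A, potential (insert b A) = potential A * yUnit (fam A b) := by
  induction A using Finset.induction_on_max with
  | empty => exact fun b _ => potential_insert_max (by simp)
  | insert c A h ih =>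
    intro b hb
    have hc : c ∉ A := fun hc => lt_irrefl c (h c hc)
    have hbc : b ≠ c := fun e => hb (e ▸ Finset.mem_insert_self c A)
    have hbA : b ∉ A := fun h => hb (Finset.mem_insert_of_mem h)
    rcases lt_or_gt_of_ne hbc with hlt | hlt
    · have h' : ∀ a ∈ insert b A, a < c := by
        intro a ha
        rcases Finset.mem_insert.1 ha with rfl | ha
        · exact hlt
        · exact h a ha
      rw [Finset.insert_comm, potential_insert_max h', potential_insert_max h, ih b hbA,
        mul_assoc, mul_assoc, yUnit_mul hbc hbA hc]
    · refine potential_insert_max fun a ha => ?_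
      rcases Finset.mem_insert.1 ha with rfl | ha
      · exact hlt
      · exact (h a ha).trans hlt

theorem potential_support (φ : Family n) :
    potential φ.support = potential φ.1.1 * yUnit φ := by
  have h := potential_insert φ.1.1 φ.1.2 φ.2
  rwa [← fam_insert_self, show insert φ.1.2 φ.1.1 = φ.support from rfl, fam_support] at h

end Potential

/-! ### Monomial parametrization of the $P_E$, and primality -/

section Toric

variable {n : ℕ} (t : BPoset n → Bool)

/-- The classes of sets whose `v` are identified by the choices `t`. -/
abbrev LinkQuot : Type := Quot (Linked fun S => some (t S))

/-- The class contains a set whose `v` is set to zero. -/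
def LinkQuot.IsZero {t : BPoset n → Bool} (q : LinkQuot t) : Prop :=
  ∃ S : BPoset n, t S = true ∧ Quot.mk _ S.1 = q

/-- Exponents of the monomials in Laurent variables indexed by sets and polynomial variables
indexed by classes. -/
abbrev Exponent : Type := (Finset (Fin n) →₀ ℤ) × (LinkQuot t →₀ ℕ)

/-- The exponent `e_{A ∪ b} - e_A`. -/
noncomputable def grad (φ : Family n) : Finset (Fin n) →₀ ℤ :=
  Finsupp.single φ.support 1 - Finsupp.single φ.1.1 1

/-- The map on exponents induced by `grad`. -/
noncomputable def yExponent : (Family n →₀ ℤ) →+ Exponent t :=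
  (AddMonoidHom.inl _ _).comp (Finsupp.liftAddHom fun φ => zmultiplesHom _ (grad φ))

open Classical in
/-- The monomial or zero in place of `v_S`. -/
noncomputable def vMon (S : Finset (Fin n)) : AddMonoidAlgebra ℂ (Exponent t) :=
  if LinkQuot.IsZero (Quot.mk _ S : LinkQuot t) then 0
  else AddMonoidAlgebra.single (0, Finsupp.single (Quot.mk _ S) 1) 1

/-- The parametrization of `P_E` by a ring that is polynomial over a Laurent polynomial ring. -/
noncomputable def param : YZRing n →ₐ[ℂ] AddMonoidAlgebra ℂ (Exponent t) :=
  aevalTower (AddMonoidAlgebra.mapDomainAlgHom ℂ ℂ (yExponent t))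
    fun φ => vMon t φ.support * AddMonoidAlgebra.single (grad φ, 0) 1

theorem param_yVar (φ : Family n) :
    param t (yVar φ) = AddMonoidAlgebra.single (grad φ, 0) 1 := by
  rw [param, yVar, aevalTower_C, AddMonoidAlgebra.mapDomainAlgHom_apply,
    AddMonoidAlgebra.mapDomain_single]
  simp [yExponent]

theorem param_zVar (φ : Family n) :
    param t (zVar φ) = vMon t φ.support * param t (yVar φ) := by
  rw [param_yVar, param, zVar, aevalTower_X]

theorem param_z (A : Finset (Fin n)) (b : Fin n) :
    param t (z A b) = vMon t (insert b A) * param t (y A b) := by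
  rw [z, param_zVar, support_fam, y]

theorem grad_fam {A : Finset (Fin n)} {b : Fin n} (hb : b ∉ A) :
    grad (fam A b) = Finsupp.single (insert b A) 1 - Finsupp.single A 1 := by
  rw [grad, support_fam]
  simp [fam, Finset.erase_eq_of_notMem hb]

theorem param_y_mul {A : Finset (Fin n)} {b c : Fin n} (hbc : b ≠ c) (hb : b ∉ A) (hc : c ∉ A) :
    param t (y A b) * param t (y (insert b A) c) =
      param t (y A c) * param t (y (insert c A) b) := by
  simp only [y, param_yVar, AddMonoidAlgebra.single_mul_single]
  rw [grad_fam hb, grad_fam hc, grad_fam (by simp [hbc.symm, hc]), grad_fam (by simp [hbc, hb]),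
    Finset.insert_comm c b A]
  simp

theorem relIdeal_le_ker_param : relIdeal n ≤ RingHom.ker (param t) := by
  rw [relIdeal, Ideal.span_le]
  rintro _ (⟨A, b, c, hbc, hb, hc, rfl⟩ | ⟨A, b, c, hbc, hb, hc, rfl⟩)
  · rw [SetLike.mem_coe, RingHom.mem_ker, map_sub, map_mul, map_mul, param_y_mul t hbc hb hc,
      sub_self]
  · rw [SetLike.mem_coe, RingHom.mem_ker, map_sub, map_mul, map_mul, param_z, param_z,
      Finset.insert_comm c b A]
    linear_combination vMon t (insert b (insert c A)) * param_y_mul t hbc hb hc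

/-- The map induced by `param` on `R_n`. -/
noncomputable def paramR : R n →+* AddMonoidAlgebra ℂ (Exponent t) :=
  Ideal.Quotient.lift (relIdeal n) (param t : YZRing n →+* _) fun _ ha =>
    RingHom.mem_ker.1 (relIdeal_le_ker_param t ha)

theorem paramR_toR (f : YZRing n) : paramR t (toR n f) = param t f := rfl

theorem isUnit_param_y (A : Finset (Fin n)) (b : Fin n) : IsUnit (param t (y A b)) := by
  have := (yUnit (fam A b)).isUnit.map (paramR t)
  rwa [coe_yUnit_fam, paramR_toR] at this

/-- Nonemptiness is needed: `v ∅` is the junk value $0$, while `vMon t ∅` can be a variable. -/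
theorem paramR_v {S : Finset (Fin n)} (hS : S.Nonempty) : paramR t (v S) = vMon t S := by
  obtain ⟨b, hb⟩ := hS
  have h := congrArg (paramR t) (toR_z (S.erase b) b)
  rw [map_mul, paramR_toR, paramR_toR, param_z, Finset.insert_erase hb] at h
  exact ((isUnit_param_y t _ _).mul_right_cancel h).symm

theorem choiceIdeal_le_ker_paramR :
    choiceIdeal (fun S => some (t S)) ≤ RingHom.ker (paramR t) := by
  refine iSup_le fun S => ?_
  have hS : S.1.Nonempty := Finset.card_pos.1 (by have := S.2; omega)
  rcases h : t S with _ | _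
  · simp only [h, stepIdeal]
    rw [Ideal.span_le]
    rintro _ ⟨b, hb, c, hc, rfl⟩
    have hl : Linked (fun S => some (t S)) (S.1.erase b) (S.1.erase c) :=
      ⟨S, congrArg some h, b, hb, c, hc, rfl, rfl⟩
    -- Sets in $\mathfrak B_n$ have at least two elements, so removing one never reaches
    -- $\emptyset$.
    have hne : ∀ b ∈ S.1, (S.1.erase b).Nonempty := fun b hb =>
      Finset.card_pos.1 (by rw [Finset.card_erase_of_mem hb]; have := S.2; omega)
    rw [SetLike.mem_coe, RingHom.mem_ker, map_sub, paramR_v t (hne b hb), paramR_v t (hne c hc),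
      vMon, vMon, Quot.sound hl, sub_self]
  · simp only [h, stepIdeal]
    rw [Ideal.span_le, Set.singleton_subset_iff, SetLike.mem_coe, RingHom.mem_ker, paramR_v t hS,
      vMon, if_pos ⟨S, h, rfl⟩]

/-- The class of `v` in the quotient of `R_n` by the ideal of the choices `t`. -/
noncomputable def vQuot : LinkQuot t → R n ⧸ choiceIdeal fun S => some (t S) :=
  Quot.lift (fun S => Ideal.Quotient.mk _ (v S)) <| by
    rintro _ _ ⟨T, hT, b, hb, c, hc, rfl, rfl⟩
    refine Ideal.Quotient.eq.2 (le_choiceIdeal _ T ?_)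
    simp only [hT]
    exact Ideal.subset_span ⟨b, hb, c, hc, rfl⟩

theorem vQuot_eq_zero {q : LinkQuot t} (h : q.IsZero) : vQuot t q = 0 := by
  obtain ⟨S, hS, rfl⟩ := h
  refine Ideal.Quotient.eq_zero_iff_mem.2 (le_choiceIdeal _ S ?_)
  simp only [hS]
  exact Ideal.mem_span_singleton_self _

/-- The potential in the quotient of `R_n` by the ideal of the choices `t`. -/
noncomputable def potentialQuot (S : Finset (Fin n)) :
    (R n ⧸ choiceIdeal fun S => some (t S))ˣ :=
  Units.map (Ideal.Quotient.mk _ : R n →+* _).toMonoidHom (potential S)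

/-- The evaluation of monomials at the potentials and the classes of `v`. -/
noncomputable def evalExponent :
    Multiplicative (Exponent t) →* R n ⧸ choiceIdeal fun S => some (t S) :=
  AddMonoidHom.toMultiplicativeLeft <| AddMonoidHom.coprod
    ((MonoidHom.toAdditive (Units.coeHom _)).comp
      (Finsupp.liftAddHom fun S => zmultiplesHom _ (Additive.ofMul (potentialQuot t S))))
    (Finsupp.liftAddHom fun q => multiplesHom _ (Additive.ofMul (vQuot t q)))

theorem evalExponent_grad (φ : Family n) :
    evalExponent t (.ofAdd (grad φ, 0)) = Ideal.Quotient.mk _ (toR n (yVar φ)) := by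
  have h : evalExponent t (.ofAdd (grad φ, 0)) =
      ((potentialQuot t φ.support * (potentialQuot t φ.1.1)⁻¹ : (_)ˣ) : R n ⧸ _) := by
    simp [evalExponent, grad, sub_eq_add_neg, ← Finsupp.single_neg]
  rw [h, potentialQuot, potentialQuot, ← map_inv, ← map_mul, potential_support,
    mul_right_comm, mul_inv_cancel, one_mul]
  rfl

theorem evalExponent_single (q : LinkQuot t) :
    evalExponent t (.ofAdd (0, Finsupp.single q 1)) = vQuot t q := by
  simp [evalExponent]

/-- The evaluation of polynomials at the potentials and the classes of `v`. -/
noncomputable def evalParam :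
    AddMonoidAlgebra ℂ (Exponent t) →+* R n ⧸ choiceIdeal fun S => some (t S) :=
  AddMonoidAlgebra.liftNCRingHom
    ((Ideal.Quotient.mk _).comp ((toR n).comp (algebraMap ℂ (YZRing n)))) (evalExponent t)
    fun _ _ => Commute.all _ _

/-- Evaluating the independent variables back at the potentials and the classes of $v_S$ undoes the
parametrization modulo the ideal, so nothing outside the ideal is killed by `param`. -/
theorem evalParam_comp_param :
    (evalParam t).comp (param t : YZRing n →+* _) = (Ideal.Quotient.mk _).comp (toR n) := by
  have hy : ∀ φ, evalParam t (param t (yVar φ)) = Ideal.Quotient.mk _ (toR n (yVar φ)) := by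
    intro φ
    rw [param_yVar, evalParam, AddMonoidAlgebra.liftNCRingHom_single, map_one, one_mul,
      evalExponent_grad]
  have hv : ∀ S, evalParam t (vMon t S) = Ideal.Quotient.mk _ (v S) := by
    intro S
    rw [vMon]
    split_ifs with h
    · rw [map_zero]
      exact (vQuot_eq_zero t h).symm
    · rw [evalParam, AddMonoidAlgebra.liftNCRingHom_single, map_one, one_mul, evalExponent_single]
      rfl
  -- Agreement on constants, $y$'s and $z$'s suffices; the $z$'s follow from $z=v\,y$.
  refine ringHom_ext (fun a => ?_) hy fun φ => ?_
  · simp only [RingHom.comp_apply, RingHom.coe_coe, AlgHom.commutes]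
    rw [evalParam, show algebraMap ℂ (AddMonoidAlgebra ℂ (Exponent t)) a =
      AddMonoidAlgebra.single 0 a from rfl, AddMonoidAlgebra.liftNCRingHom_single, ofAdd_zero,
      map_one, mul_one]
    rfl
  · simp only [RingHom.comp_apply, RingHom.coe_coe]
    rw [param_zVar, map_mul, hy, hv, toR_zVar, map_mul]

theorem comap_choiceIdeal_eq_ker :
    (choiceIdeal fun S => some (t S)).comap (toR n) = RingHom.ker (param t) := by
  apply le_antisymm
  · intro f hf
    exact choiceIdeal_le_ker_paramR t hf
  · intro f hf
    have h := RingHom.congr_fun (evalParam_comp_param t) f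
    rw [RingHom.mem_ker] at hf
    rw [Ideal.mem_comap, ← Ideal.Quotient.eq_zero_iff_mem]
    simpa [hf] using h.symm

/-- The embedding of the exponents into a free abelian group. -/
noncomputable def exponentEmbedding : Exponent t →+ (Finset (Fin n) ⊕ LinkQuot t →₀ ℤ) :=
  Finsupp.sumFinsuppAddEquivProdFinsupp.symm.toAddMonoidHom.comp
    ((AddMonoidHom.id _).prodMap (Finsupp.mapRange.addMonoidHom (Nat.castAddMonoidHom ℤ)))

theorem exponentEmbedding_injective : Function.Injective (exponentEmbedding t) := by
  refine Finsupp.sumFinsuppAddEquivProdFinsupp.symm.injective.comp ?_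
  exact Function.Injective.prodMap Function.injective_id
    (Finsupp.mapRange_injective Nat.cast Nat.cast_zero (Nat.cast_injective (R := ℤ)))

/-- The parametrization of `P_E` by Laurent monomials. -/
noncomputable def toricParam : YZRing n →ₐ[ℂ] Laurent (Finset (Fin n) ⊕ LinkQuot t) :=
  (AddMonoidAlgebra.mapDomainAlgHom ℂ ℂ (exponentEmbedding t)).comp (param t)

theorem toricParam_apply (f : YZRing n) :
    toricParam t f = AddMonoidAlgebra.mapDomain (exponentEmbedding t) (param t f) := rfl

theorem ker_toricParam :
    RingHom.ker (toricParam t) = (choiceIdeal fun S => some (t S)).comap (toR n) := by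
  rw [comap_choiceIdeal_eq_ker]
  ext f
  rw [RingHom.mem_ker, RingHom.mem_ker, toricParam_apply]
  refine ⟨fun h => AddMonoidAlgebra.mapDomain_injective (exponentEmbedding_injective t) ?_,
    fun h => ?_⟩
  · rw [h, AddMonoidAlgebra.mapDomain_zero]
  · rw [h, AddMonoidAlgebra.mapDomain_zero]

theorem isPrime_comap_choiceIdeal :
    ((choiceIdeal fun S => some (t S)).comap (toR n)).IsPrime := by
  rw [← ker_toricParam]
  exact RingHom.ker_isPrime _

theorem isPrime_choiceIdeal : (choiceIdeal fun S => some (t S)).IsPrime := by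
  have := isPrime_comap_choiceIdeal t
  rw [← Ideal.map_comap_of_surjective _ toR_surjective (choiceIdeal fun S => some (t S))]
  exact Ideal.map_isPrime_of_surjective toR_surjective (Ideal.comap_mono bot_le)

theorem isToric_comap_choiceIdeal :
    IsToric ((choiceIdeal fun S => some (t S)).comap (toR n)) := by
  refine ⟨Finset (Fin n) ⊕ LinkQuot t, inferInstance, toricParam t, fun φ => ?_, fun φ => ?_,
    (ker_toricParam t).symm⟩
  · rw [toricParam_apply, param_yVar, AddMonoidAlgebra.mapDomain_single]
    exact ⟨_, rfl⟩
  · rw [toricParam_apply, param_zVar, param_yVar, vMon]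
    split_ifs
    · left
      rw [zero_mul, AddMonoidAlgebra.mapDomain_zero]
    · right
      rw [AddMonoidAlgebra.single_mul_single, AddMonoidAlgebra.mapDomain_single, mul_one]
      exact ⟨_, rfl⟩

end Toric

/-! ### Assembling the decomposition -/

section Main

variable {n : ℕ}

theorem isRadical_choiceIdeal (s : BPoset n → Option Bool) : (choiceIdeal s).IsRadical := by
  rw [choiceIdeal_eq_iInf]
  exact Ideal.isRadical_iInf _ fun t => Ideal.isRadical_iInf _ fun _ =>
    (isPrime_choiceIdeal t).isRadical

theorem exists_idealP_eq (E : Set (BPoset n)) :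
    ∃ t : BPoset n → Bool, idealP E = choiceIdeal fun S => some (t S) := by
  classical
  refine ⟨fun S => decide (S ∈ E), ?_⟩
  rw [← idealP_eq_choiceIdeal]
  simp

theorem map_doubledChickeringIdeal_eq_iInf :
    (doubledChickeringIdeal n).map (toR n) = ⨅ E : Set (BPoset n), idealP E := by
  -- With $E=F=\emptyset$ every set is undecided, so the intersection runs over all total choices,
  -- that is, over all $E$.
  rw [map_doubledChickeringIdeal, idealI_eq_choiceIdeal subset_rfl, choiceIdeal_eq_iInf]
  apply le_antisymm
  · refine le_iInf fun E => ?_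
    obtain ⟨t, ht⟩ := exists_idealP_eq E
    rw [ht]
    exact iInf₂_le t (by simp [choiceOf])
  · refine le_iInf₂ fun t _ => ?_
    rw [← idealP_eq_choiceIdeal]
    exact iInf_le _ _

end Main

end Chickering

theorem mainTheorem4 (n : ℕ) :
    -- every `I_{E,F}` with `F` upward closed and `E ⊆ F` is radical
    (∀ E F : Set (Chickering.BPoset n), IsUpperSet F → E ⊆ F →
      (Chickering.idealI E F).IsRadical) ∧
    -- every `P_E` is prime, hence primary, and its preimage in `ℂ[y^±, z]` is prime and toric
    (∀ E : Set (Chickering.BPoset n),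
      (Chickering.idealP E).IsPrime ∧ (Chickering.idealP E).IsPrimary ∧
      ((Chickering.idealP E).comap (Chickering.toR n)).IsPrime ∧
      Chickering.IsToric ((Chickering.idealP E).comap (Chickering.toR n))) ∧
    -- the doubled Chickering ideal, as an ideal of `R_n`, is the intersection of the `P_E`
    (Chickering.doubledChickeringIdeal n).map (Chickering.toR n) =
      ⨅ E : Set (Chickering.BPoset n), Chickering.idealP E ∧
    -- the same for the doubled Chickering ideal as an ideal of `ℂ[y^±, z]`
    Chickering.doubledChickeringIdeal n =
      ⨅ E : Set (Chickering.BPoset n), (Chickering.idealP E).comap (Chickering.toR n) := by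
  refine ⟨fun E F _ hEF => ?_, fun E => ?_, Chickering.map_doubledChickeringIdeal_eq_iInf, ?_⟩
  · rw [Chickering.idealI_eq_choiceIdeal hEF]
    exact Chickering.isRadical_choiceIdeal _
  · obtain ⟨t, ht⟩ := Chickering.exists_idealP_eq E
    rw [ht]
    exact ⟨Chickering.isPrime_choiceIdeal t, (Chickering.isPrime_choiceIdeal t).isPrimary,
      Chickering.isPrime_comap_choiceIdeal t, Chickering.isToric_comap_choiceIdeal t⟩
  -- Passing to preimages loses nothing, since $\mathcal C_n'$ contains the kernel of the quotient
  -- map to $R_n$.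
  · rw [← Ideal.comap_iInf, ← Chickering.map_doubledChickeringIdeal_eq_iInf,
      Chickering.comap_map_doubledChickeringIdeal]
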